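/- Let $\mathsf{G} = \mathrm{Spec}\, A$ be an affine algebraic $\mathbb{R}$-group, i.e. $A$ is a finitely generated commutative Hopf $\mathbb{R}$-algebra, and write $\mathsf{G}(R) = \mathrm{Hom}_{\mathbb{R}\text{-alg}}(A, R)$ for the group of $R$-points of $\mathsf{G}$, for any commutative $\mathbb{R}$-algebra $R$. Assume that $\mathsf{G}$ has no imaginary connected components, i.e. every connected component of $\mathrm{Spec}\, A$ contains a rational point (the kernel of an $\mathbb{R}$-algebra morphism $A \to \mathbb{R}$). Let $(E, \rho)$ be a linear representation of $\mathsf{G}$: a finite-dimensional real vector space $E$ with a morphism of algebraic groups $\rho \colon \mathsf{G} \to \mathsf{Gl}(E) = \mathrm{Spec}\, \mathbb{R}[x_{ij}]_{\det}$, that is, a morphism of Hopf $\mathbb{R}$-algebras $\mathbb{R}[x_{ij}]_{\det} \to A$, where the $x_{ij}$ are the matrix coordinates with respect to a basis of $E$. Let $$E^{\mathsf{G}} = \{ v \in E : \text{the morphism } \mathsf{G} \to E,\ g \mapsto \rho(g)(v), \text{ is the constant map } v \},$$ that is, $\rho(g)(1 \otimes v) = 1 \otimes v$ in $R \otimes_{\mathbb{R}}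 E$ for every commutative $\mathbb{R}$-algebra $R$ and every $g \in \mathsf{G}(R)$, and let $$E^{\mathsf{G}(\mathbb{R})} = \{ v \in E : \rho(g)(v) = v \text{ for all } g \in \mathsf{G}(\mathbb{R}) \}.$$ Then $E^{\mathsf{G}} = E^{\mathsf{G}(\mathbb{R})}$ as subspaces of $E$. Moreover, let $S^\bullet E^*$ be the algebra of polynomial functions on $E$, on which $\mathsf{G}$ acts by algebra automorphisms extending the dual representation $E^*$ of $E$, and let $(S^\bullet E^*)^{\mathsf{G}}$ and $(S^\bullet E^*)^{\mathsf{G}(\mathbb{R})}$ be the subalgebras of invariant elements, defined in the same way: those $f$ for which $1 \otimes f \in R \otimes_{\mathbb{R}} S^\bullet E^*$ is fixed by $\mathsf{G}(R)$ for every commutative $\mathbb{R}$-algebra $R$, respectively those $f$ fixed by $\mathsf{G}(\mathbb{R})$. Then $(S^\bullet E^*)^{\mathsf{G}} = (S^\bullet E^*)^{\mathsf{G}(\mathbb{R})}$ as subalgebras of $S^\bullet E^*$. -/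

import Mathlib

open scoped TensorProduct Matrix

universe u v

/-- The coordinate ring `ℝ[x_ij]_det` of the affine `ℝ`-group of invertible `ι × ι` matrices. -/
def GLCoord (ι : Type*) [Fintype ι] [DecidableEq ι] : Type _ :=
  Localization.Away (Matrix.mvPolynomialX ι ι ℝ).det

namespace GLCoord

noncomputable section

variable {ι : Type*} [Fintype ι] [DecidableEq ι]

instance : CommRing (GLCoord ι) :=
  inferInstanceAs (CommRing (Localization.Away (Matrix.mvPolynomialX ι ι ℝ).det))

instance : Algebra ℝ (GLCoord ι) :=
  inferInstanceAs (Algebra ℝ (Localization.Away (Matrix.mvPolynomialX ι ι ℝ).det))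

instance : Algebra (MvPolynomial (ι × ι) ℝ) (GLCoord ι) :=
  inferInstanceAs (Algebra (MvPolynomial (ι × ι) ℝ)
    (Localization.Away (Matrix.mvPolynomialX ι ι ℝ).det))

instance : IsScalarTower ℝ (MvPolynomial (ι × ι) ℝ) (GLCoord ι) :=
  inferInstanceAs (IsScalarTower ℝ (MvPolynomial (ι × ι) ℝ)
    (Localization.Away (Matrix.mvPolynomialX ι ι ℝ).det))

instance : IsLocalization.Away (Matrix.mvPolynomialX ι ι ℝ).det (GLCoord ι) :=
  inferInstanceAs (IsLocalization.Away (Matrix.mvPolynomialX ι ι ℝ).det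
    (Localization.Away (Matrix.mvPolynomialX ι ι ℝ).det))

/-- The coordinate function `x_ij`. -/
def x (i j : ι) : GLCoord ι :=
  algebraMap (MvPolynomial (ι × ι) ℝ) (GLCoord ι) (MvPolynomial.X (i, j))

/-- The matrix `(x_ij)` of coordinate functions. -/
def genericMatrix : Matrix ι ι (GLCoord ι) := Matrix.of x

theorem genericMatrix_eq : (genericMatrix : Matrix ι ι (GLCoord ι)) =
    (algebraMap (MvPolynomial (ι × ι) ℝ) (GLCoord ι)).mapMatrix (Matrix.mvPolynomialX ι ι ℝ) := by
  ext i j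
  rfl

/-- The matrix `(x_ij)` as an invertible matrix. -/
def generic : GL ι (GLCoord ι) :=
  Matrix.GeneralLinearGroup.mk'' genericMatrix (by
    rw [genericMatrix_eq, ← RingHom.map_det]
    exact IsLocalization.Away.algebraMap_isUnit _)

variable {R : Type*} [CommRing R] [Algebra ℝ R]

/-- The `R`-point of the general linear group given by an `ℝ`-algebra morphism
`ℝ[x_ij]_det → R`: the invertible matrix of the images of the `x_ij`. -/
def toGL (f : GLCoord ι →ₐ[ℝ] R) : GL ι R :=
  Matrix.GeneralLinearGroup.map (f : GLCoord ι →+* R) generic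

@[simp] theorem toGL_apply (f : GLCoord ι →ₐ[ℝ] R) (i j : ι) :
    (toGL f : Matrix ι ι R) i j = f (x i j) := rfl

/-- The `ℝ`-algebra morphism `ℝ[x_ij]_det → R` with `x_ij ↦ M_ij`. -/
def ofGL (M : GL ι R) : GLCoord ι →ₐ[ℝ] R :=
  IsLocalization.Away.liftAlgHom (S := GLCoord ι) (Matrix.mvPolynomialX ι ι ℝ).det
    (f := MvPolynomial.aeval fun p : ι × ι => (M : Matrix ι ι R) p.1 p.2) (by
      have h := Matrix.mvPolynomialX_mapMatrix_aeval ℝ (M : Matrix ι ι R)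
      rw [AlgHom.map_det, h]
      exact M.isUnit.map Matrix.detMonoidHom)

@[simp] theorem ofGL_x (M : GL ι R) (i j : ι) : ofGL M (x i j) = (M : Matrix ι ι R) i j := by
  simp [ofGL, x, IsLocalization.Away.liftAlgHom]

theorem algHom_ext {f g : GLCoord ι →ₐ[ℝ] R} (h : ∀ i j, f (x i j) = g (x i j)) : f = g := by
  apply IsLocalization.algHom_ext (A := MvPolynomial (ι × ι) ℝ)
    (Submonoid.powers (Matrix.mvPolynomialX ι ι ℝ).det)
  ext ⟨i, j⟩
  exact h i j

open Algebra.TensorProduct in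
/-- The general linear group law: `Δ x_ij = ∑ k, x_ik ⊗ x_kj`, `ε x_ij = δ_ij`. -/
instance : Bialgebra ℝ (GLCoord ι) :=
  Bialgebra.ofAlgHom
    (ofGL (toGL includeLeft * toGL includeRight))
    (ofGL 1)
    (by
      apply algHom_ext
      intro i j
      simp [Matrix.mul_apply, TensorProduct.sum_tmul, TensorProduct.tmul_sum]
      rw [Finset.sum_comm])
    (by
      apply algHom_ext
      intro i j
      simp [Matrix.mul_apply, Matrix.one_apply, TensorProduct.ite_tmul])
    (by
      apply algHom_ext
      intro i j
      simp [Matrix.mul_apply, Matrix.one_apply, TensorProduct.tmul_ite])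

theorem comul_x (i j : ι) :
    Coalgebra.comul (R := ℝ) (x i j : GLCoord ι) = ∑ k, x i k ⊗ₜ[ℝ] x k j := by
  change ofGL _ (x i j) = _
  simp [Matrix.mul_apply]

theorem counit_x (i j : ι) :
    Coalgebra.counit (R := ℝ) (x i j : GLCoord ι) = (1 : Matrix ι ι ℝ) i j := by
  change ofGL _ (x i j) = _
  simp

/-- The antipode sends `x_ij` to the `(i, j)` entry of the inverse of the matrix `(x_ij)`. -/
instance : HopfAlgebra ℝ (GLCoord ι) :=
  HopfAlgebra.ofAlgHom (ofGL generic⁻¹)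
    (by
      apply algHom_ext
      intro i j
      have h := congrArg (fun M : GL ι (GLCoord ι) => (M : Matrix ι ι (GLCoord ι)) i j)
        (inv_mul_cancel (generic : GL ι (GLCoord ι)))
      simp only [Units.val_mul, Matrix.mul_apply, Units.val_one, Matrix.one_apply] at h
      rw [AlgHom.comp_apply, AlgHom.comp_apply, Bialgebra.comulAlgHom_apply, comul_x,
        Bialgebra.counitAlgHom_apply, counit_x, Matrix.one_apply, Algebra.ofId_apply, apply_ite
        (algebraMap ℝ (GLCoord ι)), map_one, map_zero, ← h, map_sum]
      refine Finset.sum_congr rfl fun k _ => ?_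
      refine (Algebra.TensorProduct.lift_tmul _ _ _ _ _).trans ?_
      exact congrArg (· * x k j) (ofGL_x _ _ _))
    (by
      apply algHom_ext
      intro i j
      have h := congrArg (fun M : GL ι (GLCoord ι) => (M : Matrix ι ι (GLCoord ι)) i j)
        (mul_inv_cancel (generic : GL ι (GLCoord ι)))
      simp only [Units.val_mul, Matrix.mul_apply, Units.val_one, Matrix.one_apply] at h
      rw [AlgHom.comp_apply, AlgHom.comp_apply, Bialgebra.comulAlgHom_apply, comul_x,
        Bialgebra.counitAlgHom_apply, counit_x, Matrix.one_apply, Algebra.ofId_apply, apply_ite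
        (algebraMap ℝ (GLCoord ι)), map_one, map_zero, ← h, map_sum]
      refine Finset.sum_congr rfl fun k _ => ?_
      refine (Algebra.TensorProduct.lift_tmul _ _ _ _ _).trans ?_
      exact congrArg (x i k * ·) (ofGL_x _ _ _))

end

end GLCoord

noncomputable section

/-- The group `G(R)` of `R`-points of the affine group `G = Spec A`: the `ℝ`-algebra morphisms
`A → R` under convolution. -/
abbrev GroupPoints (A : Type*) [CommRing A] [HopfAlgebra ℝ A]
    (R : Type*) [CommRing R] [Algebra ℝ R] : Type _ :=
  WithConv (A →ₐ[ℝ] R)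

/-- The point of `Spec A` underlying a rational point `A → ℝ`. -/
def rationalPoint {A : Type*} [CommRing A] [Algebra ℝ A] (g : A →ₐ[ℝ] ℝ) : PrimeSpectrum A :=
  PrimeSpectrum.comap (g : A →+* ℝ) ⊥

/-- `Spec A` has no imaginary connected components: every connected component of the (Zariski)
topological space `Spec A` contains a rational point. -/
def NoImaginaryComponents (A : Type*) [CommRing A] [Algebra ℝ A] : Prop :=
  ∀ p : PrimeSpectrum A, ∃ g : A →ₐ[ℝ] ℝ, rationalPoint g ∈ connectedComponent p

/-- A linear representation of the affine group `G = Spec A` on the finite-dimensional real vector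
space `E`: a morphism `G → GL(E)` of affine `ℝ`-groups, given by a morphism
`ℝ[x_ij]_det → A` of Hopf algebras, where the coordinates `x_ij` of `GL(E)` are those of some
basis of `E`. (Bialgebra morphisms between Hopf algebras preserve the antipode.) -/
structure LinearRep (A : Type u) [CommRing A] [HopfAlgebra ℝ A]
    (E : Type v) [AddCommGroup E] [Module ℝ E] where
  /-- The dimension of `E`. -/
  n : ℕ
  /-- The basis of `E` with respect to which the coordinates of `GL(E)` are taken. -/
  basis : Module.Basis (Fin n) ℝ E
  /-- The morphism of Hopf algebras. -/
  hom : GLCoord (Fin n) →ₐc[ℝ] A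

namespace LinearRep

variable {A : Type u} [CommRing A] [HopfAlgebra ℝ A] {E : Type v} [AddCommGroup E] [Module ℝ E]
variable (ρ : LinearRep A E) (R : Type*) [CommRing R] [Algebra ℝ R]

/-- The group morphism `G(R) → GL_n(R)` induced by a representation. -/
def matrixHom : GroupPoints A R →* GL (Fin ρ.n) R where
  toFun g := GLCoord.toGL (g.ofConv.comp (ρ.hom : GLCoord (Fin ρ.n) →ₐ[ℝ] A))
  map_one' := by
    apply Units.ext
    ext i j
    have h : Coalgebra.counit (R := ℝ) (ρ.hom (GLCoord.x i j)) = (1 : Matrix _ _ ℝ) i j := by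
      rw [CoalgHomClass.counit_comp_apply, GLCoord.counit_x]
    have h' : (GLCoord.toGL ((1 : GroupPoints A R).ofConv.comp
        (ρ.hom : GLCoord (Fin ρ.n) →ₐ[ℝ] A)) : Matrix (Fin ρ.n) (Fin ρ.n) R) i j =
        algebraMap ℝ R (Coalgebra.counit (R := ℝ) (ρ.hom (GLCoord.x i j))) := rfl
    rw [h', h, Units.val_one, Matrix.one_apply, Matrix.one_apply, apply_ite (algebraMap ℝ R),
      map_one, map_zero]
  map_mul' g h := by
    apply Units.ext
    ext i j
    rw [AlgHom.convMul_comp_bialgHom_distrib, GLCoord.toGL_apply, Units.val_mul,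
      Matrix.mul_apply]
    have h' := AlgHom.convMul_apply
      (WithConv.toConv (g.ofConv.comp (ρ.hom : GLCoord (Fin ρ.n) →ₐ[ℝ] A)))
      (WithConv.toConv (h.ofConv.comp (ρ.hom : GLCoord (Fin ρ.n) →ₐ[ℝ] A))) (GLCoord.x i j)
    rw [GLCoord.comul_x] at h'
    refine h'.trans ?_
    simp

/-- The action of `G(R)` on `R ⊗ E`. -/
def action : Representation R (GroupPoints A R) (R ⊗[ℝ] E) :=
  ((Matrix.toLinAlgEquiv (ρ.basis.baseChange R) :
    Matrix (Fin ρ.n) (Fin ρ.n) R →* Module.End R (R ⊗[ℝ] E)).comp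
      (Units.coeHom _)).comp (ρ.matrixHom R)

/-- The action of the group `G(ℝ)` of rational points on `E`. -/
def realAction : Representation ℝ (GroupPoints A ℝ) E :=
  ((Matrix.toLinAlgEquiv ρ.basis :
    Matrix (Fin ρ.n) (Fin ρ.n) ℝ →* Module.End ℝ E).comp
      (Units.coeHom _)).comp (ρ.matrixHom ℝ)

/-- The contragredient action of `G(R)` on `R ⊗ E*`: in the dual basis, `g` acts by the transpose
of the inverse of the matrix of `g`. -/
def dualAction : Representation R (GroupPoints A R) (R ⊗[ℝ] Module.Dual ℝ E) where
  toFun g := Matrix.toLinAlgEquiv (ρ.basis.dualBasis.baseChange R)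
    ((ρ.matrixHom R g)⁻¹ : GL (Fin ρ.n) R).valᵀ
  map_one' := by simp
  map_mul' g h := by simp [Matrix.transpose_mul, Module.End.mul_eq_comp]

/-- The linear inclusion `R ⊗ E* → R ⊗ S(E*)`. -/
def symIncl : R ⊗[ℝ] Module.Dual ℝ E →ₗ[R] R ⊗[ℝ] SymmetricAlgebra ℝ (Module.Dual ℝ E) :=
  (SymmetricAlgebra.ι ℝ (Module.Dual ℝ E)).baseChange R

/-- The `R`-algebra endomorphism of `R ⊗ S(E*)` extending the contragredient action of
`g ∈ G(R)` on `R ⊗ E*`. -/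
def symMap (g : GroupPoints A R) : R ⊗[ℝ] SymmetricAlgebra ℝ (Module.Dual ℝ E) →ₐ[R]
    R ⊗[ℝ] SymmetricAlgebra ℝ (Module.Dual ℝ E) :=
  Algebra.TensorProduct.lift (Algebra.ofId R _)
    (SymmetricAlgebra.lift
      (((symIncl R ∘ₗ ρ.dualAction R g).restrictScalars ℝ) ∘ₗ
        (TensorProduct.mk ℝ R (Module.Dual ℝ E) 1)))
    (fun _ _ => Commute.all _ _)

theorem symMap_symIncl (g : GroupPoints A R) (y : R ⊗[ℝ] Module.Dual ℝ E) :
    ρ.symMap R g (symIncl R y) = symIncl R (ρ.dualAction R g y) := by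
  induction y with
  | zero => simp
  | add y z hy hz => simp [hy, hz]
  | tmul r φ =>
    rw [← mul_one r, ← smul_eq_mul, ← TensorProduct.smul_tmul']
    simp only [map_smul]
    congr 1
    simp [symMap, symIncl, ← Algebra.TensorProduct.one_def]

theorem symHom_ext {f g : R ⊗[ℝ] SymmetricAlgebra ℝ (Module.Dual ℝ E) →ₐ[R]
    R ⊗[ℝ] SymmetricAlgebra ℝ (Module.Dual ℝ E)}
    (h : ∀ y, f (symIncl R y) = g (symIncl R y)) : f = g := by
  apply Algebra.TensorProduct.ext
  · ext
  · apply SymmetricAlgebra.algHom_ext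
    ext φ
    simpa [symIncl] using h (1 ⊗ₜ φ)

/-- The action of `G(R)` by `R`-algebra endomorphisms on `R ⊗ S(E*)`, where `S(E*)` is the algebra
of polynomial functions on `E`. -/
def symAction : GroupPoints A R →* (R ⊗[ℝ] SymmetricAlgebra ℝ (Module.Dual ℝ E) →ₐ[R]
    R ⊗[ℝ] SymmetricAlgebra ℝ (Module.Dual ℝ E)) where
  toFun := ρ.symMap R
  map_one' := by
    apply symHom_ext
    intro y
    simp [symMap_symIncl]
  map_mul' g h := by
    apply symHom_ext
    intro y
    simp [symMap_symIncl]

/-- The action of `G(ℝ)` on the algebra `S(E*)` of polynomial functions on `E`: the algebra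
endomorphisms extending the dual `g ↦ (φ ↦ φ ∘ g⁻¹)` of the action of `G(ℝ)` on `E`. -/
def realSymAction : GroupPoints A ℝ →* (SymmetricAlgebra ℝ (Module.Dual ℝ E) →ₐ[ℝ]
    SymmetricAlgebra ℝ (Module.Dual ℝ E)) where
  toFun g := SymmetricAlgebra.lift (SymmetricAlgebra.ι ℝ _ ∘ₗ ρ.realAction.dual g)
  map_one' := by
    apply SymmetricAlgebra.algHom_ext
    ext φ
    simp only [map_one]
    simp
  map_mul' g h := by
    apply SymmetricAlgebra.algHom_ext
    ext φ
    simp only [map_mul]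
    simp

/-- `E^G`: the vectors `v` for which the morphism `G → E`, `g ↦ g v`, is the constant map `v`, on
`R`-points for every commutative `ℝ`-algebra `R`. -/
def invariants : Submodule ℝ E where
  carrier := {v | ∀ (R : Type u) [CommRing R] [Algebra ℝ R] (g : GroupPoints A R),
    ρ.action R g (1 ⊗ₜ v) = 1 ⊗ₜ v}
  zero_mem' R _ _ g := by simp
  add_mem' hv hw R _ _ g := by simp [TensorProduct.tmul_add, hv R g, hw R g]
  smul_mem' c v hv R _ _ g := by
    rw [TensorProduct.tmul_smul, ← algebraMap_smul R c ((1 : R) ⊗ₜ[ℝ] v), map_smul, hv R g]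

/-- `E^{G(ℝ)}`: the vectors fixed by all rational points of `G`. -/
def realInvariants : Submodule ℝ E := ρ.realAction.invariants

/-- `S(E*)^G`: the polynomial functions on `E` that are fixed by `G(R)`, for every commutative
`ℝ`-algebra `R`. -/
def symInvariants : Subalgebra ℝ (SymmetricAlgebra ℝ (Module.Dual ℝ E)) where
  carrier := {f | ∀ (R : Type u) [CommRing R] [Algebra ℝ R] (g : GroupPoints A R),
    ρ.symAction R g (1 ⊗ₜ f) = 1 ⊗ₜ f}
  add_mem' hv hw R _ _ g := by simp [TensorProduct.tmul_add, hv R g, hw R g]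
  mul_mem' {v w} hv hw R _ _ g := by
    have h : (1 : R) ⊗ₜ[ℝ] (v * w) = (1 ⊗ₜ v) * (1 ⊗ₜ w) := by simp
    rw [h, map_mul, hv R g, hw R g]
  algebraMap_mem' c R _ _ g := by
    have h : (1 : R) ⊗ₜ[ℝ] algebraMap ℝ (SymmetricAlgebra ℝ (Module.Dual ℝ E)) c =
      algebraMap R _ (algebraMap ℝ R c) := by
      rw [Algebra.TensorProduct.algebraMap_apply, Algebra.algebraMap_eq_smul_one c,
        Algebra.algebraMap_eq_smul_one c, TensorProduct.tmul_smul, TensorProduct.smul_tmul']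
      simp
    rw [h, AlgHom.commutes]

/-- `S(E*)^{G(ℝ)}`: the polynomial functions on `E` fixed by all rational points of `G`. -/
def realSymInvariants : Subalgebra ℝ (SymmetricAlgebra ℝ (Module.Dual ℝ E)) where
  carrier := {f | ∀ g : GroupPoints A ℝ, ρ.realSymAction g f = f}
  add_mem' hv hw g := by simp [hv g, hw g]
  mul_mem' hv hw g := by simp [hv g, hw g]
  algebraMap_mem' c g := by simp

end LinearRep

end

/-! The crux is that real points are dense in the scheme sense: a function in `A` vanishing at all
of them is zero. An invariant vector or polynomial need only be tested at the universal point `id :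
A → A`. There the difference `g v - v` is a tensor over `A` whose coefficients vanish at all real
points, so density kills it.

For density, let `I` be the ideal of functions vanishing at all real points and `m` the augmentation
ideal. A derivation at the identity exponentiates to real points `exp (t δ)`, so it kills `I`; by
translation, `I` is stable under invariant derivations. Near the identity an Euler field acts as `k`
on `m^k / m^(k+1)`, which forces `I ⊆ m^n` for all `n`
(`realVanishingIdeal_le_augmentationIdeal_pow`). Krull and Nakayama then give `s` with `s(1) = 1`
and `s I = 0`.

Translating `s` around the group spreads this local vanishing and shows `I = I²`
(`isIdempotentElem_realVanishingIdeal`). So `I` is generated by an idempotent `e`, whose locus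
`D(e)` is clopen and has no rational point. The hypothesis on components makes it empty, so `e = 0`.
-/

noncomputable section

namespace AffineGroup

open Coalgebra (comul counit Repr coassoc_apply)
open scoped Coalgebra

/-! ### Translations and finite-dimensional orbits -/

section Coalgebra

variable {R A : Type*} [CommRing R] [AddCommGroup A] [Module R A] [Coalgebra R A]

/-- Translation by a functional on the left leg of the comultiplication:
`a ↦ ∑ ξ(a₁) a₂`. -/
def leftTranslate (ξ : A →ₗ[R] R) : A →ₗ[R] A :=
  TensorProduct.lid R A ∘ₗ ξ.rTensor A ∘ₗ comul

/-- Translation by a functional on the right leg of the comultiplication: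
`a ↦ ∑ ξ(a₂) a₁`. -/
def rightTranslate (ξ : A →ₗ[R] R) : A →ₗ[R] A :=
  TensorProduct.rid R A ∘ₗ ξ.lTensor A ∘ₗ comul

theorem leftTranslate_eq_sum {ι : Type*} {a : A} (r : Repr R a ι) (ξ : A →ₗ[R] R) :
    leftTranslate ξ a = ∑ i ∈ r.index, ξ (r.left i) • r.right i := by
  simp [leftTranslate, ← r.eq]

theorem rightTranslate_eq_sum {ι : Type*} {a : A} (r : Repr R a ι) (ξ : A →ₗ[R] R) :
    rightTranslate ξ a = ∑ i ∈ r.index, ξ (r.right i) • r.left i := by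
  simp [rightTranslate, ← r.eq]

@[simp] theorem leftTranslate_counit (a : A) : leftTranslate (R := R) counit a = a := by
  simp [leftTranslate]

@[simp] theorem rightTranslate_counit (a : A) : rightTranslate (R := R) counit a = a := by
  simp [rightTranslate]

/-- Both sides are `(ξ ⊗ η)(Δ a)`. For a real point `ξ` and a derivation `η` at the identity, this
computes the invariant derivative at `ξ` by translating `a` back to the identity. -/
theorem apply_rightTranslate (ξ η : A →ₗ[R] R) (a : A) :
    ξ (rightTranslate η a) = η (leftTranslate ξ a) := by
  simp [rightTranslate_eq_sum (ℛ R a), leftTranslate_eq_sum (ℛ R a), mul_comm]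

theorem counit_rightTranslate (ξ : A →ₗ[R] R) (a : A) :
    counit (R := R) (rightTranslate ξ a) = ξ a := by
  rw [apply_rightTranslate, leftTranslate_counit]

/-- Coassociativity: contracting the outer left leg does not interfere with splitting off a right
leg. -/
theorem comul_leftTranslate (ξ : A →ₗ[R] R) (a : A) :
    comul (R := R) (leftTranslate ξ a) = (leftTranslate ξ).rTensor A (comul a) := by
  have h : ∀ t : A ⊗[R] A, comul (R := R) (TensorProduct.lid R A (ξ.rTensor A t)) =
      (TensorProduct.lid R (A ⊗[R] A)) (ξ.rTensor (A ⊗[R] A) (comul.lTensor A t)) := by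
    intro t
    induction t with
    | zero => simp
    | add x y hx hy => simp [hx, hy]
    | tmul x y => simp
  have h' : ∀ t : (A ⊗[R] A) ⊗[R] A, (TensorProduct.lid R (A ⊗[R] A)) (ξ.rTensor (A ⊗[R] A)
      (TensorProduct.assoc R A A A t)) =
      ((TensorProduct.lid R A ∘ₗ ξ.rTensor A : A ⊗[R] A →ₗ[R] A)).rTensor A t := by
    intro t
    induction t with
    | zero => simp
    | add x y hx hy => simp only [map_add, hx, hy]
    | tmul x z =>
      induction x with
      | zero => simp
      | add x y hx hy => simp only [TensorProduct.add_tmul, map_add, hx, hy]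
      | tmul x y => simp [TensorProduct.smul_tmul']
  refine (h _).trans ?_
  rw [← coassoc_apply, h', ← LinearMap.comp_apply, ← LinearMap.rTensor_comp]
  rfl

theorem comul_rightTranslate (ξ : A →ₗ[R] R) (a : A) :
    comul (R := R) (rightTranslate ξ a) = (rightTranslate ξ).lTensor A (comul a) := by
  have h : ∀ t : A ⊗[R] A, comul (R := R) (TensorProduct.rid R A (ξ.lTensor A t)) =
      (TensorProduct.rid R (A ⊗[R] A)) (ξ.lTensor (A ⊗[R] A) (comul.rTensor A t)) := by
    intro t
    induction t with
    | zero => simp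
    | add x y hx hy => simp [hx, hy]
    | tmul x y => simp
  have h' : ∀ t : (A ⊗[R] A) ⊗[R] A, (TensorProduct.rid R (A ⊗[R] A)) (ξ.lTensor (A ⊗[R] A) t) =
      ((TensorProduct.rid R A ∘ₗ ξ.lTensor A : A ⊗[R] A →ₗ[R] A)).lTensor A
        (TensorProduct.assoc R A A A t) := by
    intro t
    induction t with
    | zero => simp
    | add x y hx hy => simp only [map_add, hx, hy]
    | tmul x z =>
      induction x with
      | zero => simp
      | add x y hx hy => simp only [TensorProduct.add_tmul, map_add, hx, hy]
      | tmul x y => simp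
  refine (h _).trans ?_
  rw [h', coassoc_apply, ← LinearMap.comp_apply, ← LinearMap.lTensor_comp]
  rfl

theorem leftTranslate_leftTranslate (ξ η : A →ₗ[R] R) (a : A) :
    leftTranslate ξ (leftTranslate η a) = leftTranslate (ξ ∘ₗ leftTranslate η) a := by
  conv_lhs => rw [leftTranslate, LinearMap.comp_apply, LinearMap.comp_apply, comul_leftTranslate]
  rw [← LinearMap.comp_apply (LinearMap.rTensor A ξ), ← LinearMap.rTensor_comp]
  rfl

theorem rightTranslate_rightTranslate (ξ η : A →ₗ[R] R) (a : A) :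
    rightTranslate ξ (rightTranslate η a) = rightTranslate (ξ ∘ₗ rightTranslate η) a := by
  conv_lhs => rw [rightTranslate, LinearMap.comp_apply, LinearMap.comp_apply, comul_rightTranslate]
  rw [← LinearMap.comp_apply (LinearMap.lTensor A ξ), ← LinearMap.lTensor_comp]
  rfl

/-- The span of all right translates of `a`. -/
def rightOrbit (R : Type*) {A : Type*} [CommRing R] [AddCommGroup A] [Module R A] [Coalgebra R A]
    (a : A) : Submodule R A where
  carrier := {b | ∃ ξ : A →ₗ[R] R, rightTranslate ξ a = b}
  zero_mem' := ⟨0, by simp [rightTranslate]⟩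
  add_mem' := by
    rintro _ _ ⟨ξ, rfl⟩ ⟨η, rfl⟩
    exact ⟨ξ + η, by simp [rightTranslate, LinearMap.lTensor_add]⟩
  smul_mem' := by
    rintro c _ ⟨ξ, rfl⟩
    exact ⟨c • ξ, by simp [rightTranslate, LinearMap.lTensor_smul]⟩

theorem mem_rightOrbit_self (a : A) : a ∈ rightOrbit R a := ⟨counit, by simp⟩

theorem rightTranslate_mem_rightOrbit (ξ : A →ₗ[R] R) {a b : A} (hb : b ∈ rightOrbit R a) :
    rightTranslate ξ b ∈ rightOrbit R a := by
  obtain ⟨η, rfl⟩ := hb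
  exact ⟨_, (rightTranslate_rightTranslate ξ η a).symm⟩

/-- The left legs of one fixed expression of `Δ a` span every right translate. This local finiteness
is what lets an invariant derivation be exponentiated. -/
instance finite_rightOrbit [IsNoetherianRing R] (a : A) : Module.Finite R (rightOrbit R a) := by
  classical
  have hle : rightOrbit R a ≤
      Submodule.span R (((ℛ R a).index.image (ℛ R a).left : Finset A) : Set A) := by
    rintro _ ⟨ξ, rfl⟩
    rw [rightTranslate_eq_sum (ℛ R a)]
    refine Submodule.sum_mem _ fun i hi => Submodule.smul_mem _ _ (Submodule.subset_span ?_)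
    exact Finset.mem_coe.2 (Finset.mem_image_of_mem _ hi)
  have := isNoetherian_span_of_finite R
    (((ℛ R a).index.image (ℛ R a).left : Finset A).finite_toSet)
  have := isNoetherian_of_le hle
  infer_instance

end Coalgebra

/-! ### Translation by points and invariant derivations -/

section Bialgebra

variable {R A : Type*} [CommRing R] [CommRing A] [Bialgebra R A]

theorem leftTranslate_mul (g : A →ₐ[R] R) (a b : A) :
    leftTranslate g.toLinearMap (a * b) =
      leftTranslate g.toLinearMap a * leftTranslate g.toLinearMap b := by
  have h : ∀ t : A ⊗[R] A, TensorProduct.lid R A (g.toLinearMap.rTensor A t) =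
      Algebra.TensorProduct.lid R A (Algebra.TensorProduct.map g (AlgHom.id R A) t) := fun _ => rfl
  simp only [leftTranslate, LinearMap.comp_apply, LinearEquiv.coe_coe, h, Bialgebra.comul_mul, map_mul]

/-- A functional that is a derivation at the counit. -/
def IsPointDerivation (δ : A →ₗ[R] R) : Prop :=
  ∀ a b, δ (a * b) = counit (R := R) a * δ b + counit (R := R) b * δ a

theorem rightTranslate_mul {δ : A →ₗ[R] R} (hδ : IsPointDerivation δ) (a b : A) :
    rightTranslate δ (a * b) = a * rightTranslate δ b + b * rightTranslate δ a := by
  have h : ∀ s t : A ⊗[R] A, TensorProduct.rid R A (δ.lTensor A (s * t)) =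
      TensorProduct.rid R A (counit.lTensor A s) * TensorProduct.rid R A (δ.lTensor A t) +
      TensorProduct.rid R A (counit.lTensor A t) * TensorProduct.rid R A (δ.lTensor A s) := by
    intro s t
    induction s with
    | zero => simp
    | add x y hx hy => simp only [add_mul, map_add, hx, hy, mul_add]; ring
    | tmul x y =>
      induction t with
      | zero => simp
      | add x y hx hy => simp only [add_mul, map_add, hx, hy, mul_add]; ring
      | tmul x' y' =>
        simp only [Algebra.TensorProduct.tmul_mul_tmul, LinearMap.lTensor_tmul,
          TensorProduct.rid_tmul, hδ y y', Algebra.smul_def, map_add, map_mul]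
        ring
  have := h (comul a) (comul b)
  simpa [rightTranslate] using this

/-- The left invariant derivation attached to a derivation at the counit. -/
def invariantDerivation {δ : A →ₗ[R] R} (hδ : IsPointDerivation δ) : Derivation R A A :=
  Derivation.mk' (rightTranslate δ) fun a b => by simp [rightTranslate_mul hδ]

end Bialgebra

section HopfAlgebra

open HopfAlgebra (antipode sum_antipode_mul_eq_algebraMap_counit)

variable {R A : Type*} [CommRing R] [CommRing A] [HopfAlgebra R A]

/-- The two translations compose to translation by the convolution of `g ∘ S` and `g`, which is the
counit by the antipode axiom. -/
theorem leftTranslate_leftTranslate_antipode (g : A →ₐ[R] R) (a : A) :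
    leftTranslate g.toLinearMap (leftTranslate (g.toLinearMap ∘ₗ antipode R) a) = a := by
  rw [leftTranslate_leftTranslate]
  convert leftTranslate_counit (R := R) a
  ext b
  simp only [LinearMap.comp_apply, leftTranslate_eq_sum (ℛ R b), map_sum, map_smul,
    AlgHom.toLinearMap_apply, smul_eq_mul, ← map_mul]
  rw [← map_sum, sum_antipode_mul_eq_algebraMap_counit]
  simp

end HopfAlgebra

/-! ### One-parameter subgroups of real points -/

section Exponential

open scoped Nat

/-- The function is `F t = ℓ (exp (t T) v)`, the matrix exponential seen through a functional. -/
theorem exists_hasSum_exp_orbit {V : Type*} [AddCommGroup V] [Module ℝ V] [Module.Finite ℝ V]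
    (T : Module.End ℝ V) (ℓ : V →ₗ[ℝ] ℝ) (v : V) :
    ∃ F : ℝ → ℝ, (∀ t, HasSum (fun n : ℕ => t ^ n * ((n ! : ℝ)⁻¹ * ℓ ((T ^ n) v))) (F t)) ∧
      HasDerivAt F (ℓ (T v)) 0 := by
  -- `V` carries no norm, so `T` is transported to coordinate space, where the operator exponential
  -- is available.
  let W := Fin (Module.finrank ℝ V) → ℝ
  let e : V ≃ₗ[ℝ] W := (Module.finBasis ℝ V).equivFun
  let T' : W →L[ℝ] W := LinearMap.toContinuousLinearMap (e.conj T)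
  have hT' : ∀ n : ℕ, (T' ^ n) (e v) = e ((T ^ n) v) := by
    intro n
    induction n with
    | zero => simp
    | succ n ih =>
      rw [pow_succ', pow_succ', mul_apply_eq_comp, ih]
      simp [T', LinearEquiv.conj_apply]
  let Φ : (W →L[ℝ] W) →L[ℝ] ℝ := LinearMap.toContinuousLinearMap
    { toFun := fun S => ℓ (e.symm (S (e v)))
      map_add' := by simp
      map_smul' := by simp }
  have hΦ : ∀ n : ℕ, Φ (T' ^ n) = ℓ ((T ^ n) v) := by
    intro n
    change ℓ (e.symm ((T' ^ n) (e v))) = _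
    rw [hT', e.symm_apply_apply]
  refine ⟨fun t => Φ (NormedSpace.exp (t • T')), fun t => ?_, ?_⟩
  · have h := (NormedSpace.exp_series_hasSum_exp' (𝕂 := ℝ) (t • T')).mapL Φ
    convert h using 2 with n
    rw [smul_pow, map_smul, map_smul, hΦ, smul_eq_mul, smul_eq_mul]
    ring
  · have h := Φ.hasFDerivAt.comp_hasDerivAt (0 : ℝ) (hasDerivAt_exp_smul_const (𝕂 := ℝ) T' 0)
    have h1 := hΦ 1
    simp only [pow_one] at h1
    exact h.congr_deriv (by simpa using h1)

theorem iterate_derivation_mul {A : Type*} [CommRing A] [Algebra ℝ A] (D : Derivation ℝ A A)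
    (n : ℕ) (a b : A) :
    D^[n] (a * b) = ∑ p ∈ Finset.HasAntidiagonal.antidiagonal n, n.choose p.1 • (D^[p.1] a * D^[p.2] b) := by
  induction n with
  | zero => simp
  | succ n ih =>
    rw [Finset.sum_antidiagonal_choose_succ_nsmul (M := A) (fun i j => D^[i] a * D^[j] b) n,
      Function.iterate_succ_apply', ih, map_sum, ← Finset.sum_add_distrib]
    refine Finset.sum_congr rfl fun p hp => ?_
    rw [map_nsmul, Derivation.leibniz, nsmul_add, Function.iterate_succ_apply',
      Function.iterate_succ_apply', smul_eq_mul, smul_eq_mul, mul_comm (D^[p.2] b),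
      Nat.choose_symm_of_eq_add (Finset.HasAntidiagonal.mem_antidiagonal.1 hp).symm]

variable {A : Type*} [CommRing A] [Bialgebra ℝ A] {δ : A →ₗ[ℝ] ℝ}

/-- The Taylor coefficients of the one-parameter subgroup generated by `δ`. -/
def taylorCoeff (hδ : IsPointDerivation δ) (n : ℕ) (a : A) : ℝ :=
  (n ! : ℝ)⁻¹ * counit (R := ℝ) ((invariantDerivation hδ)^[n] a)

theorem exists_hasSum_taylorCoeff (hδ : IsPointDerivation δ) (a : A) :
    ∃ F : ℝ → ℝ, (∀ t, HasSum (fun n : ℕ => t ^ n * taylorCoeff hδ n a) (F t)) ∧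
      HasDerivAt F (δ a) 0 := by
  let T : Module.End ℝ (rightOrbit ℝ a) :=
    (rightTranslate δ).restrict fun b hb => rightTranslate_mem_rightOrbit δ hb
  let v : rightOrbit ℝ a := ⟨a, mem_rightOrbit_self a⟩
  have hT : ∀ n : ℕ, (((T ^ n) v : rightOrbit ℝ a) : A) = (invariantDerivation hδ)^[n] a := by
    intro n
    induction n with
    | zero => rfl
    | succ n ih =>
      rw [Function.iterate_succ_apply', ← ih, pow_succ']
      rfl
  obtain ⟨F, hF, hF'⟩ := exists_hasSum_exp_orbit T
    ((counit (R := ℝ) (A := A)) ∘ₗ (rightOrbit ℝ a).subtype) v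
  refine ⟨F, fun t => ?_, ?_⟩
  · convert hF t using 3 with n
    exact congrArg (fun x => (n ! : ℝ)⁻¹ * counit (R := ℝ) x) (hT n).symm
  · convert hF' using 1
    exact (counit_rightTranslate δ a).symm

/-- The Leibniz rule with factorials divided out is a Cauchy product, which makes `exp (t δ)`
multiplicative. -/
theorem taylorCoeff_mul (hδ : IsPointDerivation δ) (n : ℕ) (a b : A) :
    taylorCoeff hδ n (a * b) =
      ∑ p ∈ Finset.HasAntidiagonal.antidiagonal n, taylorCoeff hδ p.1 a * taylorCoeff hδ p.2 b := by
  simp only [taylorCoeff]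
  rw [iterate_derivation_mul, map_sum, Finset.mul_sum]
  refine Finset.sum_congr rfl fun p hp => ?_
  obtain rfl := Finset.HasAntidiagonal.mem_antidiagonal.1 hp
  rw [map_nsmul, Bialgebra.counit_mul, nsmul_eq_mul, Nat.choose_symm_add, Nat.add_choose,
    Nat.cast_div (Nat.factorial_mul_factorial_dvd_factorial_add _ _) (by positivity)]
  push_cast
  field_simp

/-- The real point `exp (t δ)`. -/
def expPoint (hδ : IsPointDerivation δ) (t : ℝ) : A →ₐ[ℝ] ℝ :=
  AlgHom.ofLinearMap
    { toFun := fun a => ∑' n : ℕ, t ^ n * taylorCoeff hδ n a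
      map_add' := fun a b => by
        obtain ⟨F, hF, -⟩ := exists_hasSum_taylorCoeff hδ a
        obtain ⟨G, hG, -⟩ := exists_hasSum_taylorCoeff hδ b
        rw [(hF t).tsum_eq, (hG t).tsum_eq, ← ((hF t).add (hG t)).tsum_eq]
        refine tsum_congr fun n => ?_
        simp only [taylorCoeff, iterate_map_add, map_add]
        ring
      map_smul' := fun c a => by
        simp only [RingHom.id_apply, smul_eq_mul]
        rw [← tsum_mul_left]
        refine tsum_congr fun n => ?_
        have h : ∀ n : ℕ, (invariantDerivation hδ)^[n] (c • a) =
            c • (invariantDerivation hδ)^[n] a := by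
          intro n
          induction n with
          | zero => rfl
          | succ n ih => rw [Function.iterate_succ_apply', ih, Derivation.map_smul,
              Function.iterate_succ_apply']
        simp only [taylorCoeff, h, map_smul, smul_eq_mul]
        ring }
    (by
      refine (tsum_eq_single 0 fun n hn => ?_).trans ?_
      · obtain ⟨n, rfl⟩ := Nat.exists_eq_succ_of_ne_zero hn
        simp [taylorCoeff, Function.iterate_succ_apply]
      · simp [taylorCoeff])
    (by
      intro a b
      obtain ⟨F, hF, -⟩ := exists_hasSum_taylorCoeff hδ a
      obtain ⟨G, hG, -⟩ := exists_hasSum_taylorCoeff hδ b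
      refine Eq.trans ?_ (tsum_mul_tsum_eq_tsum_sum_antidiagonal_of_summable_norm
        (hF t).summable.norm (hG t).summable.norm).symm
      refine tsum_congr fun n => ?_
      rw [taylorCoeff_mul, Finset.mul_sum]
      refine Finset.sum_congr rfl fun p hp => ?_
      rw [← Finset.HasAntidiagonal.mem_antidiagonal.1 hp, pow_add]
      ring)

/-- A function vanishing at all real points has vanishing derivatives at the identity. -/
theorem pointDerivation_eq_zero (hδ : IsPointDerivation δ) {a : A}
    (ha : ∀ g : A →ₐ[ℝ] ℝ, g a = 0) : δ a = 0 := by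
  obtain ⟨F, hF, hF'⟩ := exists_hasSum_taylorCoeff hδ a
  -- `F t` is the value of `a` at the real point `exp (t δ)`.
  have h : F = fun _ => 0 := by
    funext t
    rw [← (hF t).tsum_eq]
    exact ha (expPoint hδ t)
  rw [h] at hF'
  exact hF'.unique (hasDerivAt_const _ _)

end Exponential

/-! ### The vanishing ideal of the real points -/

section VanishingIdeal

/-- The ideal of the functions that vanish at all real points. -/
def realVanishingIdeal (A : Type*) [CommRing A] [Algebra ℝ A] : Ideal A :=
  ⨅ g : A →ₐ[ℝ] ℝ, RingHom.ker g

theorem mem_realVanishingIdeal {A : Type*} [CommRing A] [Algebra ℝ A] {a : A} :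
    a ∈ realVanishingIdeal A ↔ ∀ g : A →ₐ[ℝ] ℝ, g a = 0 := by
  simp [realVanishingIdeal, RingHom.mem_ker]

theorem lid_rTensor_lTensor {A B M : Type*} [AddCommGroup A] [Module ℝ A] [AddCommGroup B]
    [Module ℝ B] [AddCommGroup M] [Module ℝ M] (g : A →ₗ[ℝ] ℝ) (μ : B →ₗ[ℝ] M) (w : A ⊗[ℝ] B) :
    TensorProduct.lid ℝ M (g.rTensor M (μ.lTensor A w)) =
      μ (TensorProduct.lid ℝ B (g.rTensor B w)) := by
  induction w with
  | zero => simp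
  | add x y hx hy => simp only [map_add, hx, hy]
  | tmul x y => simp

/-- A tensor that is killed by all real points has coefficients in the vanishing ideal. -/
theorem exists_sum_tmul_of_rTensor_eq_zero {A M κ : Type*} [CommRing A] [Algebra ℝ A]
    [AddCommGroup M] [Module ℝ M] (c : Module.Basis κ ℝ M) (t : A ⊗[ℝ] M)
    (ht : ∀ g : A →ₐ[ℝ] ℝ, g.toLinearMap.rTensor M t = 0) :
    ∃ b : κ →₀ A, (∀ i, b i ∈ realVanishingIdeal A) ∧ b.sum (fun i a => a ⊗ₜ c i) = t := by
  classical
  refine ⟨TensorProduct.equivFinsuppOfBasisRight c t, fun i => ?_, ?_⟩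
  · rw [mem_realVanishingIdeal]
    intro g
    have h : ∀ t : A ⊗[ℝ] M, g (TensorProduct.rid ℝ A ((c.coord i).lTensor A t)) =
        TensorProduct.rid ℝ ℝ ((c.coord i).lTensor ℝ (g.toLinearMap.rTensor M t)) := by
      intro t
      induction t with
      | zero => simp
      | add x y hx hy => simp only [map_add, hx, hy]
      | tmul x y => simp
    rw [TensorProduct.equivFinsuppOfBasisRight_apply, h, ht, map_zero, map_zero]
  · rw [← TensorProduct.equivFinsuppOfBasisRight_symm_apply, LinearEquiv.symm_apply_apply]

variable {A : Type*} [CommRing A]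

theorem leftTranslate_mem_realVanishingIdeal [Bialgebra ℝ A] (g : A →ₐ[ℝ] ℝ) {a : A}
    (ha : a ∈ realVanishingIdeal A) :
    leftTranslate g.toLinearMap a ∈ realVanishingIdeal A := by
  rw [mem_realVanishingIdeal] at ha ⊢
  intro h
  -- Composing `h` with translation by `g` gives the real point `g h`.
  exact ha (AlgHom.ofLinearMap (h.toLinearMap ∘ₗ leftTranslate g.toLinearMap)
    (by simp [leftTranslate, Algebra.TensorProduct.one_def])
    (fun a b => by simp [leftTranslate_mul]))

theorem rightTranslate_mem_realVanishingIdeal [Bialgebra ℝ A] {δ : A →ₗ[ℝ] ℝ}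
    (hδ : IsPointDerivation δ) {a : A} (ha : a ∈ realVanishingIdeal A) :
    rightTranslate δ a ∈ realVanishingIdeal A := by
  rw [mem_realVanishingIdeal]
  intro g
  -- The invariant derivative at `g` is `δ` applied to the translate by `g`, which again vanishes at
  -- all real points.
  refine (apply_rightTranslate g.toLinearMap δ a).trans (pointDerivation_eq_zero hδ ?_)
  exact mem_realVanishingIdeal.1 (leftTranslate_mem_realVanishingIdeal g ha)

/-- The inverse of a real point. -/
def antipodePoint [HopfAlgebra ℝ A] (g : A →ₐ[ℝ] ℝ) : A →ₐ[ℝ] ℝ :=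
  AlgHom.ofLinearMap (g.toLinearMap ∘ₗ HopfAlgebra.antipode ℝ)
    (by simp) (fun a b => by simp [HopfAlgebra.antipode_mul_antidistrib, mul_comm])

theorem antipode_mem_realVanishingIdeal [HopfAlgebra ℝ A] {a : A}
    (ha : a ∈ realVanishingIdeal A) : HopfAlgebra.antipode ℝ a ∈ realVanishingIdeal A := by
  rw [mem_realVanishingIdeal] at ha ⊢
  intro g
  exact ha (antipodePoint g)

/-! ### The formal neighbourhood of the identity -/

/-- The augmentation ideal, i.e. the maximal ideal of the identity element. -/
def augmentationIdeal (A : Type*) [CommRing A] [Bialgebra ℝ A] : Ideal A :=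
  RingHom.ker (Bialgebra.counitAlgHom ℝ A)

theorem mem_augmentationIdeal [Bialgebra ℝ A] {a : A} :
    a ∈ augmentationIdeal A ↔ counit (R := ℝ) a = 0 := Iff.rfl

theorem sub_counit_mem_augmentationIdeal [Bialgebra ℝ A] (a : A) :
    a - algebraMap ℝ A (counit (R := ℝ) a) ∈ augmentationIdeal A := by
  simp [mem_augmentationIdeal]

theorem realVanishingIdeal_le_augmentationIdeal [Bialgebra ℝ A] :
    realVanishingIdeal A ≤ augmentationIdeal A :=
  iInf_le _ (Bialgebra.counitAlgHom ℝ A)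

/-- `A` acts on `m / m²` through the counit, so finitely many generators over `A` already generate
over `ℝ`. -/
instance finite_cotangent_augmentationIdeal [Bialgebra ℝ A] [IsNoetherianRing A] :
    Module.Finite ℝ (augmentationIdeal A).Cotangent := by
  have : Module.Finite A (augmentationIdeal A).Cotangent :=
    Module.Finite.of_surjective _ (augmentationIdeal A).toCotangent_surjective
  obtain ⟨s, hs⟩ := Module.Finite.fg_top (R := A) (M := (augmentationIdeal A).Cotangent)
  refine ⟨s, eq_top_iff.2 fun x _ => ?_⟩
  have hx : x ∈ Submodule.span A (s : Set (augmentationIdeal A).Cotangent) := hs ▸ trivial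
  induction hx using Submodule.span_induction with
  | mem x h => exact Submodule.subset_span h
  | zero => exact zero_mem _
  | add x y _ _ hx hy => exact add_mem (hx trivial) (hy trivial)
  | smul a x _ hx =>
    have h := Ideal.Cotangent.smul_eq_zero_of_mem (sub_counit_mem_augmentationIdeal a) x
    rw [sub_smul, algebraMap_smul, sub_eq_zero] at h
    rw [h]
    exact Submodule.smul_mem _ _ (hx trivial)

/-- Projection onto the augmentation ideal. -/
def augmentationProj (A : Type*) [CommRing A] [Bialgebra ℝ A] : A →ₗ[ℝ] augmentationIdeal A where
  toFun a := ⟨_, sub_counit_mem_augmentationIdeal a⟩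
  map_add' a b := by ext; simp; ring
  map_smul' c a := by ext; simp [Algebra.smul_def, mul_sub]

/-- The derivation at the identity attached to a tangent vector. -/
def tangentDerivation [Bialgebra ℝ A] (ξ : (augmentationIdeal A).Cotangent →ₗ[ℝ] ℝ) :
    A →ₗ[ℝ] ℝ :=
  ξ ∘ₗ ((augmentationIdeal A).toCotangent.restrictScalars ℝ) ∘ₗ augmentationProj A

theorem tangentDerivation_apply [Bialgebra ℝ A] (ξ : (augmentationIdeal A).Cotangent →ₗ[ℝ] ℝ)
    (a : A) : tangentDerivation ξ a =
      ξ ((augmentationIdeal A).toCotangent (augmentationProj A a)) := rfl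

/-- The defect in the product rule comes from `(a - ε a)(b - ε b)`, which lies in `m²`. -/
theorem isPointDerivation_tangentDerivation [Bialgebra ℝ A]
    (ξ : (augmentationIdeal A).Cotangent →ₗ[ℝ] ℝ) : IsPointDerivation (tangentDerivation ξ) := by
  intro a b
  have h : (augmentationIdeal A).toCotangent (augmentationProj A (a * b)) =
      (augmentationIdeal A).toCotangent (counit (R := ℝ) a • augmentationProj A b +
        counit (R := ℝ) b • augmentationProj A a) := by
    rw [Ideal.toCotangent_eq, pow_two]
    convert Ideal.mul_mem_mul (sub_counit_mem_augmentationIdeal a)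
      (sub_counit_mem_augmentationIdeal b) using 1
    simp [augmentationProj, Algebra.smul_def]
    ring
  simp only [tangentDerivation_apply]
  rw [h, map_add, LinearMap.map_smul_of_tower, LinearMap.map_smul_of_tower, map_add, map_smul,
    map_smul, smul_eq_mul, smul_eq_mul]

/-- The `x i` lift a basis of `m / m²`, and the `δ i` come from the dual basis. -/
theorem exists_coordinates (A : Type*) [CommRing A] [Bialgebra ℝ A] [IsNoetherianRing A] :
    ∃ (n : ℕ) (x : Fin n → A) (δ : Fin n → A →ₗ[ℝ] ℝ), (∀ i, x i ∈ augmentationIdeal A) ∧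
      (∀ i, IsPointDerivation (δ i)) ∧ ∀ a ∈ augmentationIdeal A,
        ∑ i, δ i a • x i - a ∈ augmentationIdeal A ^ 2 := by
  let b := Module.finBasis ℝ (augmentationIdeal A).Cotangent
  choose y hy using fun i => (augmentationIdeal A).toCotangent_surjective (b i)
  refine ⟨_, fun i => y i, fun i => tangentDerivation (b.coord i), fun i => (y i).2,
    fun i => isPointDerivation_tangentDerivation _, fun a ha => ?_⟩
  have hp : augmentationProj A a = ⟨a, ha⟩ := by
    ext
    simp [augmentationProj, mem_augmentationIdeal.1 ha]
  have h : (augmentationIdeal A).toCotangent (∑ i, tangentDerivation (b.coord i) a • y i) =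
      (augmentationIdeal A).toCotangent ⟨a, ha⟩ := by
    rw [map_sum]
    conv_rhs => rw [← b.sum_repr ((augmentationIdeal A).toCotangent ⟨a, ha⟩)]
    refine Finset.sum_congr rfl fun i _ => ?_
    rw [LinearMap.map_smul_of_tower, hy, tangentDerivation_apply, hp]
    rfl
  have := (augmentationIdeal A).toCotangent_eq.1 h
  simpa using this

theorem realVanishingIdeal_le_augmentationIdeal_pow [Bialgebra ℝ A] [IsNoetherianRing A] (n : ℕ) :
    realVanishingIdeal A ≤ augmentationIdeal A ^ n := by
  obtain ⟨r, x, δ, hx, hδ, hsum⟩ := exists_coordinates A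
  set m := augmentationIdeal A
  -- The Euler field: its linear part at the identity is the identity of `m / m²`, so by Leibniz it
  -- acts as the scalar `k` on `m^k / m^(k+1)`.
  let Θ : Derivation ℝ A A := ∑ i, x i • invariantDerivation (hδ i)
  have hΘ : ∀ a, Θ a = ∑ i, x i * rightTranslate (δ i) a := by
    intro a
    have h : ∀ s : Finset (Fin r), (∑ i ∈ s, x i • invariantDerivation (hδ i)) a =
        ∑ i ∈ s, x i * rightTranslate (δ i) a := by
      classical
      intro s
      induction s using Finset.induction_on with
      | empty => simp
      | insert i s hi ih =>
        rw [Finset.sum_insert hi, Finset.sum_insert hi, Derivation.add_apply, ih]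
        rfl
    exact h _
  have hΘ1 : ∀ a ∈ m, Θ a - a ∈ m ^ 2 := by
    intro a ha
    -- Each derivative is compared with its value at the identity, which is `δ i a`; the difference
    -- lies in `m`, and the factor `x i` brings it into `m²`.
    have h : Θ a - a = ∑ i, x i * (rightTranslate (δ i) a - algebraMap ℝ A (δ i a)) +
        (∑ i, δ i a • x i - a) := by
      simp only [hΘ, mul_sub, Finset.sum_sub_distrib, Algebra.smul_def, mul_comm]
      ring
    rw [h]
    refine add_mem (sum_mem fun i _ => ?_) (hsum a ha)
    rw [pow_two]
    refine Ideal.mul_mem_mul (hx i) ?_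
    have := sub_counit_mem_augmentationIdeal (rightTranslate (δ i) a)
    rwa [counit_rightTranslate] at this
  have hΘn : ∀ k, ∀ a ∈ m ^ k, Θ a - k • a ∈ m ^ (k + 1) := by
    intro k
    induction k with
    | zero =>
      intro a _
      rw [zero_smul, sub_zero, zero_add, pow_one, hΘ]
      exact sum_mem fun i _ => m.mul_mem_right _ (hx i)
    | succ k ih =>
      intro a ha
      rw [pow_succ'] at ha
      induction ha using Submodule.mul_induction_on' with
      | mem_mul_mem a ha b hb =>
        have h : Θ (a * b) - (k + 1) • (a * b) = a * (Θ b - k • b) + (Θ a - a) * b := by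
          simp only [Derivation.leibniz, smul_eq_mul, nsmul_eq_mul, Nat.cast_add, Nat.cast_one]
          ring
        rw [h]
        refine add_mem ?_ ?_
        · rw [pow_succ']
          exact Ideal.mul_mem_mul ha (ih b hb)
        · have := Ideal.mul_mem_mul (hΘ1 a ha) hb
          rwa [← pow_add, add_comm 2 k] at this
      | add a _ b _ ha hb =>
        rw [map_add, smul_add, add_sub_add_comm]
        exact add_mem ha hb
  induction n with
  | zero => simp
  | succ n ih =>
    -- The step below divides by `n`, so `n = 0` is separate; there the counit itself is a real
    -- point.
    rcases Nat.eq_zero_or_pos n with rfl | hn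
    · simpa using realVanishingIdeal_le_augmentationIdeal
    intro a ha
    -- The derivatives of `a` stay in the vanishing ideal, hence in `m^n` by induction; the
    -- coordinates supply one more factor. As `Θ a` is also `n a` modulo `m^(n+1)`, the membership
    -- rises by one order.
    have h1 : Θ a ∈ m ^ (n + 1) := by
      rw [hΘ, pow_succ']
      exact sum_mem fun i _ => Ideal.mul_mem_mul (hx i)
        (ih (rightTranslate_mem_realVanishingIdeal (hδ i) ha))
    have h2 : n • a ∈ m ^ (n + 1) := by
      have := sub_mem h1 (hΘn n a (ih ha))
      rwa [sub_sub_cancel] at this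
    have h3 := (m ^ (n + 1)).mul_mem_left (algebraMap ℝ A (n : ℝ)⁻¹) h2
    rwa [nsmul_eq_mul, ← map_natCast (algebraMap ℝ A), ← mul_assoc, ← map_mul,
      inv_mul_cancel₀ (by positivity), map_one, one_mul] at h3

/-- Krull's intersection theorem turns `I ⊆ ⋂ m^n` into `I ⊆ m I`, and Nakayama's lemma gives `s`.
-/
theorem exists_counit_eq_one_and_mul_eq_zero (A : Type*) [CommRing A] [Bialgebra ℝ A]
    [IsNoetherianRing A] :
    ∃ s : A, counit (R := ℝ) s = 1 ∧ ∀ a ∈ realVanishingIdeal A, s * a = 0 := by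
  have hle : realVanishingIdeal A ≤ augmentationIdeal A • realVanishingIdeal A := by
    intro a ha
    obtain ⟨r, hr⟩ := ((augmentationIdeal A).mem_iInf_smul_pow_eq_bot_iff a).1
      ((Submodule.mem_iInf _).2 fun n => by
        simpa using realVanishingIdeal_le_augmentationIdeal_pow n ha)
    rw [← hr]
    exact Submodule.smul_mem_smul r.2 ha
  obtain ⟨s, hs, h⟩ := Submodule.exists_sub_one_mem_and_smul_eq_zero_of_fg_of_le_smul _ _
    (IsNoetherian.noetherian _) hle
  refine ⟨s, ?_, h⟩
  rw [mem_augmentationIdeal, map_sub, Bialgebra.counit_one, sub_eq_zero] at hs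
  exact hs

/-- For `f` in `I`, the tensor `Δ(s)(1 ⊗ f)` vanishes at every real point of its first leg, so it
lies in the image of `I ⊗ I`. Contracting it by `S(a) b` returns `ε(s) f = f`, and `I` is stable
under the antipode. -/
theorem isIdempotentElem_realVanishingIdeal [HopfAlgebra ℝ A] [IsNoetherianRing A] :
    IsIdempotentElem (realVanishingIdeal A) := by
  refine le_antisymm Ideal.mul_le_right fun f hf => ?_
  obtain ⟨s, hs1, hs⟩ := exists_counit_eq_one_and_mul_eq_zero A
  let μ : A →ₗ[ℝ] realVanishingIdeal A :=
    -- The target is `I` rather than `A`, so that the second leg of `t` remains in the ideal.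
    ((LinearMap.toSpanSingleton A (realVanishingIdeal A) ⟨f, hf⟩)).restrictScalars ℝ
  have hμ : ∀ a, (μ a : A) = a * f := fun a => rfl
  have hkill : ∀ g : A →ₐ[ℝ] ℝ, leftTranslate g.toLinearMap s * f = 0 := by
    intro g
    -- `s` kills the translate of `f` by the inverse of `g`; translating back by `g` moves the
    -- multiplier instead.
    have h0 := hs _ (leftTranslate_mem_realVanishingIdeal (antipodePoint g) hf)
    change s * leftTranslate (g.toLinearMap ∘ₗ HopfAlgebra.antipode ℝ) f = 0 at h0
    rw [← leftTranslate_leftTranslate_antipode g f, ← leftTranslate_mul, h0, map_zero]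
  let t : A ⊗[ℝ] realVanishingIdeal A := μ.lTensor A (comul s)
  have ht : ∀ g : A →ₐ[ℝ] ℝ, g.toLinearMap.rTensor _ t = 0 := by
    intro g
    refine (TensorProduct.lid ℝ _).map_eq_zero_iff.1 ((lid_rTensor_lTensor _ μ _).trans ?_)
    exact Subtype.ext (hkill g)
  obtain ⟨b, hb, hbt⟩ := exists_sum_tmul_of_rTensor_eq_zero
    (Module.Basis.ofVectorSpace ℝ (realVanishingIdeal A)) t ht
  let ν : A ⊗[ℝ] realVanishingIdeal A →ₗ[ℝ] A :=
    LinearMap.mul' ℝ A ∘ₗ TensorProduct.map (HopfAlgebra.antipode ℝ)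
      ((realVanishingIdeal A).subtype.restrictScalars ℝ)
  have hν : ∀ w : A ⊗[ℝ] A, ν (μ.lTensor A w) =
      LinearMap.mul' ℝ A ((HopfAlgebra.antipode ℝ).rTensor A w) * f := by
    intro w
    induction w with
    | zero => simp
    | add x y hx hy => simp only [map_add, hx, hy, add_mul]
    | tmul x y => simp [ν, hμ, mul_assoc]
  have hνt : ν t = f := by
    rw [hν, HopfAlgebra.mul_antipode_rTensor_comul_apply, hs1, map_one, one_mul]
  rw [← hνt, ← hbt, Finsupp.sum, map_sum]
  refine sum_mem fun i _ => ?_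
  simp only [ν, LinearMap.comp_apply, TensorProduct.map_tmul, LinearMap.mul'_apply]
  exact Ideal.mul_mem_mul (antipode_mem_realVanishingIdeal (hb i)) (Subtype.mem _)

/-- The real points of an affine algebraic group without imaginary components are dense. -/
theorem realVanishingIdeal_eq_bot [HopfAlgebra ℝ A] [IsNoetherianRing A]
    (hA : NoImaginaryComponents A) : realVanishingIdeal A = ⊥ := by
  obtain ⟨e, he, hI⟩ := ((realVanishingIdeal A).isIdempotentElem_iff_of_fg
    (IsNoetherian.noetherian _)).1 isIdempotentElem_realVanishingIdeal
  have hmem : e ∈ realVanishingIdeal A := hI ▸ Ideal.mem_span_singleton_self e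
  have hclopen : IsClopen (PrimeSpectrum.basicOpen e : Set (PrimeSpectrum A)) :=
    PrimeSpectrum.isClopen_iff.2 ⟨e, he, rfl⟩
  have hbot : PrimeSpectrum.basicOpen e = ⊥ := by
    rw [eq_bot_iff]
    intro p hp
    obtain ⟨g, hg⟩ := hA p
    -- The clopen set `D(e)` contains the whole component of `p`, hence a rational point, where `e`
    -- must nevertheless vanish.
    have h : e ∉ (rationalPoint g).asIdeal := hclopen.connectedComponent_subset hp hg
    refine (h ?_).elim
    change g e ∈ (⊥ : Ideal ℝ)
    exact mem_realVanishingIdeal.1 hmem g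
  rw [PrimeSpectrum.basicOpen_eq_bot_iff] at hbot
  have he0 : e = 0 := by
    obtain ⟨n, hn⟩ := hbot
    rcases Nat.eq_zero_or_pos n with rfl | hpos
    · rw [pow_zero] at hn
      rw [← mul_one e, hn, mul_zero]
    · rwa [he.pow_eq hpos.ne'] at hn
  rw [hI, he0]
  simp

end VanishingIdeal

end AffineGroup

/-! ### Invariants and the universal point -/

namespace LinearRep

open AffineGroup

theorem map_toLinAlgEquiv_baseChange {A R E ι : Type*} [CommRing A] [Algebra ℝ A] [CommRing R]
    [Algebra ℝ R] [AddCommGroup E] [Module ℝ E] [Fintype ι] [DecidableEq ι]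
    (b : Module.Basis ι ℝ E) (g : A →ₐ[ℝ] R) (M : Matrix ι ι A) (v : E) :
    g.toLinearMap.rTensor E (Matrix.toLinAlgEquiv (b.baseChange A) M (1 ⊗ₜ v)) =
      Matrix.toLinAlgEquiv (b.baseChange R) (M.map g) (1 ⊗ₜ v) := by
  rw [Matrix.toLinAlgEquiv_apply, Matrix.toLinAlgEquiv_apply, map_sum]
  refine Finset.sum_congr rfl fun i _ => ?_
  simp [Matrix.mulVec, dotProduct, TensorProduct.smul_tmul', Algebra.smul_def]

/-- A tensor killed by all real points is zero. -/
theorem eq_zero_of_rTensor_eq_zero {A M : Type*} [CommRing A] [HopfAlgebra ℝ A]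
    [IsNoetherianRing A] [AddCommGroup M] [Module ℝ M] (hA : NoImaginaryComponents A)
    (t : A ⊗[ℝ] M) (ht : ∀ g : A →ₐ[ℝ] ℝ, g.toLinearMap.rTensor M t = 0) : t = 0 := by
  obtain ⟨b, hb, rfl⟩ :=
    exists_sum_tmul_of_rTensor_eq_zero (Module.Basis.ofVectorSpace ℝ M) t ht
  refine Finset.sum_eq_zero fun i _ => ?_
  have := hb i
  rw [realVanishingIdeal_eq_bot hA, Ideal.mem_bot] at this
  simp [this]

variable {A : Type u} [CommRing A] [HopfAlgebra ℝ A] {E : Type v} [AddCommGroup E] [Module ℝ E]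
variable (ρ : LinearRep A E) {R : Type*} [CommRing R] [Algebra ℝ R]

/-- The universal point of the group. -/
def universalPoint (A : Type*) [CommRing A] [HopfAlgebra ℝ A] : GroupPoints A A :=
  WithConv.toConv (AlgHom.id ℝ A)

theorem matrixHom_universalPoint (g : GroupPoints A R) :
    (ρ.matrixHom A (universalPoint A)).map g.ofConv.toRingHom = ρ.matrixHom R g := by
  apply Units.ext
  ext i j
  rfl

/-- Yoneda: every point `g : A → R` is the image of the universal point under `g`, and the action is
compatible with change of scalars. -/
theorem rTensor_action_universalPoint (g : GroupPoints A R) (v : E) :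
    g.ofConv.toLinearMap.rTensor E (ρ.action A (universalPoint A) (1 ⊗ₜ v)) =
      ρ.action R g (1 ⊗ₜ v) :=
  map_toLinAlgEquiv_baseChange ρ.basis g.ofConv _ v

theorem rTensor_dualAction_universalPoint (g : GroupPoints A R) (φ : Module.Dual ℝ E) :
    g.ofConv.toLinearMap.rTensor _ (ρ.dualAction A (universalPoint A) (1 ⊗ₜ φ)) =
      ρ.dualAction R g (1 ⊗ₜ φ) := by
  refine (map_toLinAlgEquiv_baseChange ρ.basis.dualBasis g.ofConv _ φ).trans ?_
  change _ = Matrix.toLinAlgEquiv (ρ.basis.dualBasis.baseChange R)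
    ((ρ.matrixHom R g)⁻¹ : GL (Fin ρ.n) R).valᵀ _
  rw [← matrixHom_universalPoint, ← map_inv]
  rfl

/-- Both sides are algebra morphisms in `f`, so it suffices to compare them on `E*`. -/
theorem rTensor_symAction_universalPoint (g : GroupPoints A R)
    (f : SymmetricAlgebra ℝ (Module.Dual ℝ E)) :
    g.ofConv.toLinearMap.rTensor _ (ρ.symAction A (universalPoint A) (1 ⊗ₜ f)) =
      ρ.symAction R g (1 ⊗ₜ f) := by
  let F : SymmetricAlgebra ℝ (Module.Dual ℝ E) →ₐ[ℝ]
      R ⊗[ℝ] SymmetricAlgebra ℝ (Module.Dual ℝ E) :=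
    (Algebra.TensorProduct.map g.ofConv (AlgHom.id ℝ _)).comp
      (((ρ.symAction A (universalPoint A)).restrictScalars ℝ).comp
        Algebra.TensorProduct.includeRight)
  let G : SymmetricAlgebra ℝ (Module.Dual ℝ E) →ₐ[ℝ]
      R ⊗[ℝ] SymmetricAlgebra ℝ (Module.Dual ℝ E) :=
    ((ρ.symAction R g).restrictScalars ℝ).comp Algebra.TensorProduct.includeRight
  have hnat : ∀ y : A ⊗[ℝ] Module.Dual ℝ E, g.ofConv.toLinearMap.rTensor _ (symIncl A y) =
      symIncl R (g.ofConv.toLinearMap.rTensor _ y) := by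
    intro y
    induction y with
    | zero => simp
    | add x y hx hy => simp only [map_add, hx, hy]
    | tmul x y => simp [symIncl]
  have h : F = G := by
    apply SymmetricAlgebra.algHom_ext
    ext φ
    change g.ofConv.toLinearMap.rTensor _ (ρ.symMap A (universalPoint A)
      (1 ⊗ₜ SymmetricAlgebra.ι ℝ _ φ)) = ρ.symMap R g (1 ⊗ₜ SymmetricAlgebra.ι ℝ _ φ)
    have h1 : (1 : A) ⊗ₜ[ℝ] SymmetricAlgebra.ι ℝ _ φ = symIncl A (1 ⊗ₜ φ) := by simp [symIncl]
    have h2 : (1 : R) ⊗ₜ[ℝ] SymmetricAlgebra.ι ℝ _ φ = symIncl R (1 ⊗ₜ φ) := by simp [symIncl]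
    rw [h1, h2, symMap_symIncl, symMap_symIncl, hnat, rTensor_dualAction_universalPoint]
  exact DFunLike.congr_fun h f

theorem toLinAlgEquiv_baseChange_real {E ι : Type*} [AddCommGroup E] [Module ℝ E] [Fintype ι]
    [DecidableEq ι] (b : Module.Basis ι ℝ E) (M : Matrix ι ι ℝ) (v : E) :
    Matrix.toLinAlgEquiv (b.baseChange ℝ) M (1 ⊗ₜ v) = 1 ⊗ₜ Matrix.toLinAlgEquiv b M v := by
  rw [Matrix.toLinAlgEquiv_apply, Matrix.toLinAlgEquiv_apply, TensorProduct.tmul_sum]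
  refine Finset.sum_congr rfl fun i _ => ?_
  simp [Matrix.mulVec, dotProduct]

theorem action_real (g : GroupPoints A ℝ) (v : E) :
    ρ.action ℝ g (1 ⊗ₜ v) = 1 ⊗ₜ ρ.realAction g v :=
  toLinAlgEquiv_baseChange_real ρ.basis _ v

theorem dualAction_real (g : GroupPoints A ℝ) (φ : Module.Dual ℝ E) :
    ρ.dualAction ℝ g (1 ⊗ₜ φ) = 1 ⊗ₜ ρ.realAction.dual g φ := by
  refine (toLinAlgEquiv_baseChange_real ρ.basis.dualBasis _ φ).trans ?_
  have h := LinearMap.congr_fun (Matrix.toLin_transpose (B₁ := ρ.basis) (B₂ := ρ.basis)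
    ((ρ.matrixHom ℝ g)⁻¹ : GL (Fin ρ.n) ℝ).val) φ
  rw [← map_inv] at h ⊢
  exact congrArg _ h

theorem symAction_real (g : GroupPoints A ℝ) (f : SymmetricAlgebra ℝ (Module.Dual ℝ E)) :
    ρ.symAction ℝ g (1 ⊗ₜ f) = 1 ⊗ₜ ρ.realSymAction g f := by
  let F : SymmetricAlgebra ℝ (Module.Dual ℝ E) →ₐ[ℝ]
      ℝ ⊗[ℝ] SymmetricAlgebra ℝ (Module.Dual ℝ E) :=
    (ρ.symAction ℝ g).comp Algebra.TensorProduct.includeRight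
  let G : SymmetricAlgebra ℝ (Module.Dual ℝ E) →ₐ[ℝ]
      ℝ ⊗[ℝ] SymmetricAlgebra ℝ (Module.Dual ℝ E) :=
    Algebra.TensorProduct.includeRight.comp (ρ.realSymAction g)
  have h : F = G := by
    apply SymmetricAlgebra.algHom_ext
    ext φ
    change ρ.symMap ℝ g (1 ⊗ₜ SymmetricAlgebra.ι ℝ _ φ) =
      1 ⊗ₜ (SymmetricAlgebra.lift _ (SymmetricAlgebra.ι ℝ _ φ))
    have h2 : ∀ φ : Module.Dual ℝ E,
        (1 : ℝ) ⊗ₜ[ℝ] SymmetricAlgebra.ι ℝ _ φ = symIncl ℝ (1 ⊗ₜ φ) := by simp [symIncl]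
    rw [h2, symMap_symIncl, dualAction_real, ← h2]
    simp
  exact DFunLike.congr_fun h f

theorem invariants_eq_realInvariants [IsNoetherianRing A] (hA : NoImaginaryComponents A) :
    ρ.invariants = ρ.realInvariants := by
  ext v
  constructor
  · intro hv g
    -- The invariants test only algebras in universe `u`, which need not contain `ℝ`; `A` does lie
    -- there, so the universal point is used and then specialised to `ℝ`.
    have h := congrArg (g.ofConv.toLinearMap.rTensor E) (hv A (universalPoint A))
    rw [rTensor_action_universalPoint, action_real] at h
    simpa using congrArg (TensorProduct.lid ℝ E) h
  · intro hv
    -- Being fixed by every real `g` says that each specialisation of this difference vanishes;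
    -- density makes the difference itself zero, and it governs all `R`-points.
    have h0 : ρ.action A (universalPoint A) (1 ⊗ₜ v) - 1 ⊗ₜ v = 0 := by
      refine eq_zero_of_rTensor_eq_zero hA _ fun g => ?_
      have h := ρ.rTensor_action_universalPoint (WithConv.toConv g) v
      rw [action_real, hv (WithConv.toConv g)] at h
      rw [map_sub]
      refine sub_eq_zero.2 (h.trans ?_)
      simp
    intro R _ _ g
    rw [← rTensor_action_universalPoint, sub_eq_zero.1 h0]
    simp

theorem symInvariants_eq_realSymInvariants [IsNoetherianRing A] (hA : NoImaginaryComponents A) :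
    ρ.symInvariants = ρ.realSymInvariants := by
  ext f
  constructor
  · intro hf g
    have h := congrArg (g.ofConv.toLinearMap.rTensor _) (hf A (universalPoint A))
    rw [rTensor_symAction_universalPoint, symAction_real] at h
    simpa using congrArg (TensorProduct.lid ℝ _) h
  · intro hf
    have h0 : ρ.symAction A (universalPoint A) (1 ⊗ₜ f) - 1 ⊗ₜ f = 0 := by
      refine eq_zero_of_rTensor_eq_zero hA _ fun g => ?_
      have h := ρ.rTensor_symAction_universalPoint (WithConv.toConv g) f
      rw [symAction_real, hf (WithConv.toConv g)] at h
      rw [map_sub]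
      refine sub_eq_zero.2 (h.trans ?_)
      simp
    intro R _ _ g
    rw [← rTensor_symAction_universalPoint, sub_eq_zero.1 h0]
    simp

end LinearRep

end

theorem mainTheorem1 {A : Type u} [CommRing A] [HopfAlgebra ℝ A] [Algebra.FiniteType ℝ A]
    (hA : NoImaginaryComponents A)
    {E : Type v} [AddCommGroup E] [Module ℝ E] [FiniteDimensional ℝ E] (ρ : LinearRep A E) :
    ρ.invariants = ρ.realInvariants ∧ ρ.symInvariants = ρ.realSymInvariants := by
  have : IsNoetherianRing A := Algebra.FiniteType.isNoetherianRing ℝ A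
  exact ⟨ρ.invariants_eq_realInvariants hA, ρ.symInvariants_eq_realSymInvariants hA⟩
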